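/- Let $(\mathcal{A},\mathbb{E},\mathfrak{s})$ be an extriangulated category in the sense of Nakaoka and Palu. Subcategories are full, non-empty and closed under isomorphisms. A \emph{length function} is a map $\Theta$ from isomorphism classes of objects of $\mathcal{A}$ to $\mathbb{N}$ such that $\Theta(X)=0$ if and only if $X\cong 0$, and $\Theta(L)\le\Theta(X)+\Theta(M)$ for every $\mathbb{E}$-triangle $X\to L\to M\overset{\delta}{\dashrightarrow}$, with equality if $\delta=0$. An $\mathbb{E}$-triangle $X\xrightarrow{x}L\xrightarrow{y}M\dashrightarrow$ is \emph{$\Theta$-stable} if $\Theta(L)=\Theta(X)+\Theta(M)$; then $x$ is called a \emph{$\Theta$-inflation} with cone $M$, and $y$ a \emph{$\Theta$-deflation}. Assume that $(\mathcal{A},\Theta)$ is an \emph{extriangulated length category}: $\Theta$ is a length function and every morphism $f$ of $\mathcal{A}$ factors as $f=j\circ i$ with $i$ a $\Theta$-deflation and $j$ a $\Theta$-inflation. A \emph{torsion class} is a subcategory $\mathcal{T}$ such that $M\in\mathcal{T}$ whenever there is a $\Theta$-deflation $T\to M$ with $T\in\mathcal{T}$, and such that $M\in\mathcal{T}$ whenever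 there is a $\Theta$-stable $\mathbb{E}$-triangle $T\to M\to T'\dashrightarrow$ with $T,T'\in\mathcal{T}$. A \emph{torsion-free class} is a subcategory $\mathcal{F}$ such that $M\in\mathcal{F}$ whenever there is a $\Theta$-inflation $M\to F$ with $F\in\mathcal{F}$, and such that $M\in\mathcal{F}$ whenever there is a $\Theta$-stable $\mathbb{E}$-triangle $F\to M\to F'\dashrightarrow$ with $F,F'\in\mathcal{F}$. Let $\mathrm{tors}_\Theta(\mathcal{A})$ and $\mathrm{torf}_\Theta(\mathcal{A})$ be the sets of torsion classes and of torsion-free classes, ordered by inclusion. For a class $\mathcal{X}$ of objects put $\mathcal{X}^{\perp}=\{M\mid \mathrm{Hom}(X,M)=0\ \forall X\in\mathcal{X}\}$ and ${}^{\perp}\mathcal{X}=\{M\mid \mathrm{Hom}(M,X)=0\ \forall X\in\mathcal{X}\}$, and let $\mathrm{Filt}_\Theta(\mathcal{X})$ consist of the objects $M$ that admit a finite chain $0=M_0\to M_1\to\cdots\to M_n=M$ ($n\ge 0$) of $\Theta$-inflations with cones in $\mathcal{X}$. Then: (1) $\mathrm{tors}_\Theta(\mathcal{A})$ is a complete lattice,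 and for every subset $\mathcal{L}$ of it $$\bigvee\mathcal{L}={}^{\perp}\Bigl(\bigcap_{\mathcal{T}\in\mathcal{L}}\mathcal{T}^{\perp}\Bigr)=\mathrm{Filt}_\Theta\Bigl(\bigcup_{\mathcal{T}\in\mathcal{L}}\mathcal{T}\Bigr),\qquad \bigwedge\mathcal{L}=\bigcap_{\mathcal{T}\in\mathcal{L}}\mathcal{T}.$$ (2) $\mathrm{torf}_\Theta(\mathcal{A})$ is a complete lattice, and for every subset $\mathcal{L}'$ of it $$\bigvee\mathcal{L}'=\Bigl(\bigcap_{\mathcal{F}\in\mathcal{L}'}{}^{\perp}\mathcal{F}\Bigr)^{\perp}=\mathrm{Filt}_\Theta\Bigl(\bigcup_{\mathcal{F}\in\mathcal{L}'}\mathcal{F}\Bigr),\qquad \bigwedge\mathcal{L}'=\bigcap_{\mathcal{F}\in\mathcal{L}'}\mathcal{F}.$$ (3) $\mathcal{T}\mapsto\mathcal{T}^{\perp}$ is an isomorphism of complete lattices $\mathrm{tors}_\Theta(\mathcal{A})\to\mathrm{torf}_\Theta(\mathcal{A})^{\mathrm{op}}$. (4) $P=\mathrm{tors}_\Theta(\mathcal{A})$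 is completely semidistributive: for all $x\in P$ and $L\subseteq P$, if $x\wedge y=x\wedge z$ for all $y,z\in L$, then $x\wedge\bigvee L=x\wedge y$ for all $y\in L$; and if $x\vee y=x\vee z$ for all $y,z\in L$, then $x\vee\bigwedge L=x\vee y$ for all $y\in L$. (5) $\mathrm{tors}_\Theta(\mathcal{A})$ is algebraic: each of its elements is a join of compact elements, where $c$ is compact if $c\le\bigvee L$ always implies $c\le\bigvee S$ for some finite $S\subseteq L$. -/

import Mathlib

open CategoryTheory CategoryTheory.Limits Opposite

universe w v u

namespace Extri

/-! ### Extensions for an additive bifunctor -/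

section Bifunctor

variable {C : Type u} [Category.{v} C]

/-- The abelian group `𝔼(Z, X)`. -/
abbrev Extn (F : Cᵒᵖ ⥤ C ⥤ AddCommGrpCat.{w}) (Z X : C) : Type w :=
  ((F.obj (op Z)).obj X : Type w)

/-- `a_* : 𝔼(Z, X) → 𝔼(Z, X')` for `a : X ⟶ X'`. -/
def push (F : Cᵒᵖ ⥤ C ⥤ AddCommGrpCat.{w}) {Z X X' : C} (a : X ⟶ X') :
    Extn F Z X →+ Extn F Z X' :=
  ((F.obj (op Z)).map a).hom

/-- `c^* : 𝔼(Z, X) → 𝔼(Z', X)` for `c : Z' ⟶ Z`. -/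
def pull (F : Cᵒᵖ ⥤ C ⥤ AddCommGrpCat.{w}) {Z Z' X : C} (c : Z' ⟶ Z) :
    Extn F Z X →+ Extn F Z' X :=
  ((F.map c.op).app X).hom

/-- The extension `δ ⊕ δ' ∈ 𝔼(Z ⊕ Z', X ⊕ X')`, whose components are `δ`, `0`, `0`, `δ'`. -/
noncomputable def sumExtn [Preadditive C] [HasBinaryBiproducts C]
    (F : Cᵒᵖ ⥤ C ⥤ AddCommGrpCat.{w}) {Z X Z' X' : C}
    (δ : Extn F Z X) (δ' : Extn F Z' X') : Extn F (Z ⊞ Z') (X ⊞ X') :=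
  push F biprod.inl (pull F biprod.fst δ) + push F biprod.inr (pull F biprod.snd δ')

end Bifunctor

/-- An extriangulated structure `(𝔼, 𝔰)` on an additive category `C`, in the sense of
Nakaoka and Palu. The correspondence `𝔰` is encoded by the relation `Realizes δ x y`,
which means `𝔰(δ) = [X --x--> Y --y--> Z]`. -/
structure ExtriangulatedStructure (C : Type u) [Category.{v} C] [Preadditive C]
    [HasZeroObject C] [HasBinaryBiproducts C] where
  /-- the bifunctor `𝔼 : Cᵒᵖ × C ⥤ Ab` -/
  E : Cᵒᵖ ⥤ C ⥤ AddCommGrpCat.{w}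
  /-- (ET1): `𝔼` is additive in each variable -/
  additive_right : ∀ Z : Cᵒᵖ, (E.obj Z).Additive
  additive_left : ∀ X : C, (E.flip.obj X).Additive
  Realizes : ∀ {X Y Z : C}, Extn E Z X → (X ⟶ Y) → (Y ⟶ Z) → Prop
  /-- `𝔰(δ)` is exactly one equivalence class of sequences `X ⟶ Y ⟶ Z` -/
  exists_realizes : ∀ {X Z : C} (δ : Extn E Z X),
    ∃ (Y : C) (x : X ⟶ Y) (y : Y ⟶ Z), Realizes δ x y
  realizes_iff : ∀ {X Y Y' Z : C} {δ : Extn E Z X} {x : X ⟶ Y} {y : Y ⟶ Z}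
    (x' : X ⟶ Y') (y' : Y' ⟶ Z), Realizes δ x y →
    (Realizes δ x' y' ↔ ∃ h : Y ≅ Y', x ≫ h.hom = x' ∧ h.hom ≫ y' = y)
  /-- (ET2): `𝔰` is a realization -/
  exists_middle : ∀ {X Y Z X' Y' Z' : C} {δ : Extn E Z X} {δ' : Extn E Z' X'}
    {x : X ⟶ Y} {y : Y ⟶ Z} {x' : X' ⟶ Y'} {y' : Y' ⟶ Z'},
    Realizes δ x y → Realizes δ' x' y' →
    ∀ (a : X ⟶ X') (c : Z ⟶ Z'), push E a δ = pull E c δ' →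
    ∃ b : Y ⟶ Y', x ≫ b = a ≫ x' ∧ y ≫ c = b ≫ y'
  /-- (ET2): `𝔰` is additive -/
  realizes_zero : ∀ X Z : C,
    Realizes (0 : Extn E Z X) (biprod.inl : X ⟶ X ⊞ Z) (biprod.snd : X ⊞ Z ⟶ Z)
  realizes_sum : ∀ {X Y Z X' Y' Z' : C} {δ : Extn E Z X} {δ' : Extn E Z' X'}
    {x : X ⟶ Y} {y : Y ⟶ Z} {x' : X' ⟶ Y'} {y' : Y' ⟶ Z'},
    Realizes δ x y → Realizes δ' x' y' →
    Realizes (sumExtn E δ δ') (biprod.map x x') (biprod.map y y')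
  /-- (ET3) -/
  et3 : ∀ {X Y Z X' Y' Z' : C} {δ : Extn E Z X} {δ' : Extn E Z' X'}
    {x : X ⟶ Y} {y : Y ⟶ Z} {x' : X' ⟶ Y'} {y' : Y' ⟶ Z'},
    Realizes δ x y → Realizes δ' x' y' →
    ∀ (a : X ⟶ X') (b : Y ⟶ Y'), x ≫ b = a ≫ x' →
    ∃ c : Z ⟶ Z', y ≫ c = b ≫ y' ∧ push E a δ = pull E c δ'
  /-- (ET3)ᵒᵖ -/
  et3_op : ∀ {X Y Z X' Y' Z' : C} {δ : Extn E Z X} {δ' : Extn E Z' X'}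
    {x : X ⟶ Y} {y : Y ⟶ Z} {x' : X' ⟶ Y'} {y' : Y' ⟶ Z'},
    Realizes δ x y → Realizes δ' x' y' →
    ∀ (b : Y ⟶ Y') (c : Z ⟶ Z'), y ≫ c = b ≫ y' →
    ∃ a : X ⟶ X', x ≫ b = a ≫ x' ∧ push E a δ = pull E c δ'
  /-- (ET4) -/
  et4 : ∀ {X₁ X₂ X₃ D G : C} {δ : Extn E D X₁} {δ' : Extn E G X₂}
    {f : X₁ ⟶ X₂} {f' : X₂ ⟶ D} {g : X₂ ⟶ X₃} {g' : X₃ ⟶ G},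
    Realizes δ f f' → Realizes δ' g g' →
    ∃ (K : C) (h' : X₃ ⟶ K) (d : D ⟶ K) (e : K ⟶ G) (δ'' : Extn E K X₁),
      Realizes δ'' (f ≫ g) h' ∧ g ≫ h' = f' ≫ d ∧ h' ≫ e = g' ∧
      Realizes (push E f' δ') d e ∧ pull E d δ'' = δ ∧ push E f δ'' = pull E e δ'
  /-- (ET4)ᵒᵖ -/
  et4_op : ∀ {X₁ X₂ X₃ D G : C} {δ : Extn E X₂ D} {δ' : Extn E X₃ G}
    {f' : D ⟶ X₁} {f : X₁ ⟶ X₂} {g' : G ⟶ X₂} {g : X₂ ⟶ X₃},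
    Realizes δ f' f → Realizes δ' g' g →
    ∃ (K : C) (h' : K ⟶ X₁) (d : D ⟶ K) (e : K ⟶ G) (δ'' : Extn E X₃ K),
      Realizes δ'' h' (f ≫ g) ∧ h' ≫ f = e ≫ g' ∧ d ≫ h' = f' ∧
      Realizes (pull E g' δ) d e ∧ push E e δ'' = δ' ∧ push E d δ = pull E g δ''

section Length

variable {C : Type u} [Category.{v} C] [Preadditive C] [HasZeroObject C] [HasBinaryBiproducts C]
  (𝓔 : ExtriangulatedStructure.{w} C) (Θ : C → ℕ)

/-- `Θ` is a length function: a map from isomorphism classes of objects to `ℕ`, vanishing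
exactly on zero objects, subadditive on `𝔼`-triangles and additive on those with `δ = 0`. -/
structure IsLengthFunction : Prop where
  iso_invariant : ∀ {X Y : C}, (X ≅ Y) → Θ X = Θ Y
  eq_zero_iff : ∀ X : C, Θ X = 0 ↔ IsZero X
  le_add : ∀ {X L M : C} {δ : Extn 𝓔.E M X} {x : X ⟶ L} {y : L ⟶ M},
    𝓔.Realizes δ x y → Θ L ≤ Θ X + Θ M
  eq_add : ∀ {X L M : C} {x : X ⟶ L} {y : L ⟶ M},
    𝓔.Realizes (0 : Extn 𝓔.E M X) x y → Θ L = Θ X + Θ M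

/-- `X --x--> L --y--> M` is (with some `δ`) a `Θ`-stable `𝔼`-triangle. -/
def IsStable {X L M : C} (x : X ⟶ L) (y : L ⟶ M) : Prop :=
  (∃ δ : Extn 𝓔.E M X, 𝓔.Realizes δ x y) ∧ Θ L = Θ X + Θ M

/-- `Θ`-inflations. -/
def IsInflation {X L : C} (x : X ⟶ L) : Prop :=
  ∃ (M : C) (y : L ⟶ M), IsStable 𝓔 Θ x y

/-- `Θ`-deflations. -/
def IsDeflation {L M : C} (y : L ⟶ M) : Prop :=
  ∃ (X : C) (x : X ⟶ L), IsStable 𝓔 Θ x y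

/-- `Θ`-admissible morphisms. -/
def IsAdmissible {M N : C} (f : M ⟶ N) : Prop :=
  ∃ (X : C) (i : M ⟶ X) (j : X ⟶ N), IsDeflation 𝓔 Θ i ∧ IsInflation 𝓔 Θ j ∧ i ≫ j = f

/-- `((C, 𝔼, 𝔰), Θ)` is an extriangulated length category. -/
structure IsLengthCategory : Prop where
  isLengthFunction : IsLengthFunction 𝓔 Θ
  isAdmissible : ∀ {M N : C} (f : M ⟶ N), IsAdmissible 𝓔 Θ f

/-- `Fac_Θ(S)`. -/
def fac (S : ObjectProperty C) : ObjectProperty C :=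
  fun M => ∃ (X : C) (y : X ⟶ M), S X ∧ IsDeflation 𝓔 Θ y

/-- `Sub_Θ(S)`. -/
def sub (S : ObjectProperty C) : ObjectProperty C :=
  fun M => ∃ (X : C) (x : M ⟶ X), S X ∧ IsInflation 𝓔 Θ x

/-- `S ∗_Θ T`. -/
def star (S T : ObjectProperty C) : ObjectProperty C :=
  fun M => ∃ (X Y : C) (x : X ⟶ M) (y : M ⟶ Y), S X ∧ T Y ∧ IsStable 𝓔 Θ x y

/-- `Filt_Θ(S)`: the objects `M` with a finite chain `0 = M₀ ↣ M₁ ↣ ⋯ ↣ Mₙ = M` of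
`Θ`-inflations whose cones lie in `S`. -/
inductive filt (S : ObjectProperty C) : ObjectProperty C
  | zero {M : C} (hM : IsZero M) : filt S M
  | step {M N Z : C} (f : M ⟶ N) (g : N ⟶ Z) (hM : filt S M)
      (hfg : IsStable 𝓔 Θ f g) (hZ : S Z) : filt S N

/-- Torsion classes in `(C, Θ)`: (non-empty, full, isomorphism-closed) subcategories `T` with
`Fac_Θ(T) ⊆ T` and `T ∗_Θ T ⊆ T`. -/
structure TorsionClass where
  obj : ObjectProperty C
  nonempty : ∃ X : C, obj X
  isClosedUnderIso : obj.IsClosedUnderIsomorphisms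
  fac_le : fac 𝓔 Θ obj ≤ obj
  star_le : star 𝓔 Θ obj obj ≤ obj

/-- Torsion-free classes in `(C, Θ)`: (non-empty, full, isomorphism-closed) subcategories `F`
with `Sub_Θ(F) ⊆ F` and `F ∗_Θ F ⊆ F`. -/
structure TorsionFreeClass where
  obj : ObjectProperty C
  nonempty : ∃ X : C, obj X
  isClosedUnderIso : obj.IsClosedUnderIsomorphisms
  sub_le : sub 𝓔 Θ obj ≤ obj
  star_le : star 𝓔 Θ obj obj ≤ obj

end Length

/-- Complete semidistributivity of a complete lattice. -/
def IsCompletelySemidistributive (P : Type*) [CompleteLattice P] : Prop :=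
  ∀ (x : P) (L : Set P),
    ((∀ y ∈ L, ∀ z ∈ L, x ⊓ y = x ⊓ z) → ∀ y ∈ L, x ⊓ sSup L = x ⊓ y) ∧
    ((∀ y ∈ L, ∀ z ∈ L, x ⊔ y = x ⊔ z) → ∀ y ∈ L, x ⊔ sInf L = x ⊔ y)

/-- A complete lattice is algebraic if every element is a join of compact elements, where `c` is
compact if `c ≤ ⋁ L` implies `c ≤ ⋁ S` for some finite `S ⊆ L`. -/
def IsAlgebraicLattice (P : Type*) [CompleteLattice P] : Prop :=
  ∀ x : P, ∃ K : Set P, x = sSup K ∧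
    ∀ c ∈ K, ∀ L : Set P, c ≤ sSup L → ∃ S : Set P, S ⊆ L ∧ S.Finite ∧ c ≤ sSup S

end Extri

/-!
A retract of an object is at most as long as the object, because the idempotent defining it factors
as a `Θ`-deflation followed by a `Θ`-inflation. Hence a zero `Θ`-inflation has zero source and a
zero `Θ`-deflation has zero target, and so `S^⊥` is closed under `Θ`-subobjects whenever `S` is
closed under `Θ`-quotients, and dually. If `S` is closed under `Θ`-quotients, every object outside
`S^⊥` has a nonzero `Θ`-subobject in `S`; splitting these off one at a time, which ends because the
length drops, filters every object of `^⊥(S^⊥)` by `S`. Therefore `Filt S = ^⊥(S^⊥)`, the map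
`T ↦ T^⊥` is an anti-isomorphism from torsion classes to torsion-free classes, and it carries the
meets, which are intersections, to the formulas for joins.

The same dévissage proves the meet half of semidistributivity for torsion classes and for
torsion-free classes, and the anti-isomorphism turns the latter into the join half for torsion
classes. Filtrations are finite, so the torsion class generated by a single object is compact.
-/

namespace Extri

section Triangles

variable {C : Type u} [Category.{v} C] [Preadditive C] [HasZeroObject C] [HasBinaryBiproducts C]
  {𝓔 : ExtriangulatedStructure.{w} C} {Θ : C → ℕ}

namespace ExtriangulatedStructure

lemma realizes_iso_zero {X Y Z : C} (e : X ≅ Y) (hZ : IsZero Z) :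
    𝓔.Realizes (0 : Extn 𝓔.E Z X) e.hom (0 : Y ⟶ Z) :=
  (𝓔.realizes_iff _ _ (𝓔.realizes_zero X Z)).2
    ⟨(isoBiprodZero hZ).symm ≪≫ e, by simp, hZ.eq_of_tgt _ _⟩

lemma realizes_zero_iso {X Y Z : C} (hX : IsZero X) (e : Y ≅ Z) :
    𝓔.Realizes (0 : Extn 𝓔.E Z X) (0 : X ⟶ Y) e.hom :=
  (𝓔.realizes_iff _ _ (𝓔.realizes_zero X Z)).2
    ⟨(isoZeroBiprod hX).symm ≪≫ e.symm, hX.eq_of_src _ _, by simp⟩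

lemma subsingleton_extn_of_isZero_left {X Z : C} (hZ : IsZero Z) :
    Subsingleton (Extn 𝓔.E Z X) :=
  have := 𝓔.additive_left X
  AddCommGrpCat.subsingleton_of_isZero ((𝓔.E.flip.obj X).map_isZero hZ.op)

lemma subsingleton_extn_of_isZero_right {X Z : C} (hX : IsZero X) :
    Subsingleton (Extn 𝓔.E Z X) :=
  have := 𝓔.additive_right (op Z)
  AddCommGrpCat.subsingleton_of_isZero ((𝓔.E.obj (op Z)).map_isZero hX)

variable {X L M : C} {δ : Extn 𝓔.E M X} {x : X ⟶ L} {y : L ⟶ M}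

lemma exists_lift (h : 𝓔.Realizes δ x y) {W : C} (f : W ⟶ L) (hf : f ≫ y = 0) :
    ∃ g : W ⟶ X, g ≫ x = f := by
  obtain ⟨g, hg, -⟩ :=
    𝓔.et3_op (realizes_iso_zero (Iso.refl W) (isZero_zero C)) h f 0 (by simp [hf])
  exact ⟨g, by simpa using hg.symm⟩

lemma exists_desc (h : 𝓔.Realizes δ x y) {W : C} (f : L ⟶ W) (hf : x ≫ f = 0) :
    ∃ g : M ⟶ W, y ≫ g = f := by
  obtain ⟨g, hg, -⟩ :=
    𝓔.et3 h (realizes_zero_iso (isZero_zero C) (Iso.refl W)) 0 f (by simp [hf])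
  exact ⟨g, by simpa using hg⟩

lemma isIso_left_of_isZero (h : 𝓔.Realizes δ x y) (hM : IsZero M) : IsIso x := by
  have := subsingleton_extn_of_isZero_left (𝓔 := 𝓔) (X := X) hM
  obtain rfl : δ = 0 := Subsingleton.elim _ _
  obtain ⟨e, rfl, -⟩ := (𝓔.realizes_iff _ _ (realizes_iso_zero (Iso.refl X) hM)).1 h
  infer_instance

lemma isIso_right_of_isZero (h : 𝓔.Realizes δ x y) (hX : IsZero X) : IsIso y := by
  have := subsingleton_extn_of_isZero_right (𝓔 := 𝓔) (Z := M) hX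
  obtain rfl : δ = 0 := Subsingleton.elim _ _
  obtain ⟨e, -, he⟩ := (𝓔.realizes_iff _ _ (realizes_zero_iso hX (Iso.refl M))).1 h
  rw [(Iso.eq_inv_comp e).2 he]
  infer_instance

end ExtriangulatedStructure

namespace IsStable

variable {X L M : C} {x : X ⟶ L} {y : L ⟶ M}

lemma exists_lift (h : IsStable 𝓔 Θ x y) {W : C} (f : W ⟶ L) (hf : f ≫ y = 0) :
    ∃ g : W ⟶ X, g ≫ x = f :=
  ExtriangulatedStructure.exists_lift h.1.choose_spec f hf

lemma exists_desc (h : IsStable 𝓔 Θ x y) {W : C} (f : L ⟶ W) (hf : x ≫ f = 0) :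
    ∃ g : M ⟶ W, y ≫ g = f :=
  ExtriangulatedStructure.exists_desc h.1.choose_spec f hf

lemma isIso_left (h : IsStable 𝓔 Θ x y) (hM : IsZero M) : IsIso x :=
  ExtriangulatedStructure.isIso_left_of_isZero h.1.choose_spec hM

lemma isIso_right (h : IsStable 𝓔 Θ x y) (hX : IsZero X) : IsIso y :=
  ExtriangulatedStructure.isIso_right_of_isZero h.1.choose_spec hX

end IsStable

end Triangles

open ExtriangulatedStructure ZeroObject

section Length

variable {C : Type u} [Category.{v} C] [Preadditive C] [HasZeroObject C] [HasBinaryBiproducts C]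
  {𝓔 : ExtriangulatedStructure.{w} C} {Θ : C → ℕ}

namespace IsLengthFunction

lemma length_pos (hΘ : IsLengthFunction 𝓔 Θ) {X : C} (hX : ¬ IsZero X) : 0 < Θ X :=
  Nat.pos_of_ne_zero (mt (hΘ.eq_zero_iff X).1 hX)

lemma isStable_iso_zero (hΘ : IsLengthFunction 𝓔 Θ) {X Y Z : C} (e : X ≅ Y) (hZ : IsZero Z) :
    IsStable 𝓔 Θ e.hom (0 : Y ⟶ Z) :=
  ⟨⟨0, realizes_iso_zero e hZ⟩, by rw [hΘ.iso_invariant e, (hΘ.eq_zero_iff Z).2 hZ, add_zero]⟩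

lemma isStable_zero_iso (hΘ : IsLengthFunction 𝓔 Θ) {X Y Z : C} (hX : IsZero X) (e : Y ≅ Z) :
    IsStable 𝓔 Θ (0 : X ⟶ Y) e.hom :=
  ⟨⟨0, realizes_zero_iso hX e⟩, by rw [hΘ.iso_invariant e, (hΘ.eq_zero_iff X).2 hX, zero_add]⟩

lemma isStable_middle_iso (hΘ : IsLengthFunction 𝓔 Θ) {X L L' M : C} {x : X ⟶ L} {y : L ⟶ M}
    (h : IsStable 𝓔 Θ x y) (e : L ≅ L') : IsStable 𝓔 Θ (x ≫ e.hom) (e.inv ≫ y) := by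
  obtain ⟨⟨δ, hδ⟩, hL⟩ := h
  exact ⟨⟨δ, (𝓔.realizes_iff _ _ hδ).2 ⟨e, rfl, by simp⟩⟩, by rw [← hΘ.iso_invariant e, hL]⟩

lemma isIso_of_isInflation (hΘ : IsLengthFunction 𝓔 Θ) {X L : C} {x : X ⟶ L}
    (hx : IsInflation 𝓔 Θ x) (hL : Θ L ≤ Θ X) : IsIso x := by
  obtain ⟨M, y, h⟩ := hx
  have hLXM : Θ L = Θ X + Θ M := h.2
  exact h.isIso_left ((hΘ.eq_zero_iff M).1 (by omega))

lemma isIso_of_isDeflation (hΘ : IsLengthFunction 𝓔 Θ) {L M : C} {y : L ⟶ M}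
    (hy : IsDeflation 𝓔 Θ y) (hL : Θ L ≤ Θ M) : IsIso y := by
  obtain ⟨X, x, h⟩ := hy
  have hLXM : Θ L = Θ X + Θ M := h.2
  exact h.isIso_right ((hΘ.eq_zero_iff X).1 (by omega))

/- In the octahedron (ET4) two of the four triangles are stable, so subadditivity along the other
two bounds the same total length from both sides and forces equality. -/
lemma exists_isStable_comp_inflation (hΘ : IsLengthFunction 𝓔 Θ) {X₁ X₂ X₃ D G : C}
    {f : X₁ ⟶ X₂} {f' : X₂ ⟶ D} {g : X₂ ⟶ X₃} {g' : X₃ ⟶ G} (hf : IsStable 𝓔 Θ f f')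
    (hg : IsStable 𝓔 Θ g g') :
    ∃ (K : C) (h' : X₃ ⟶ K) (d : D ⟶ K) (e : K ⟶ G),
      IsStable 𝓔 Θ (f ≫ g) h' ∧ IsStable 𝓔 Θ d e := by
  obtain ⟨⟨δ, hδ⟩, hX₂⟩ := hf
  obtain ⟨⟨δ', hδ'⟩, hX₃⟩ := hg
  obtain ⟨K, h', d, e, δ'', hcomp, -, -, hK, -, -⟩ := 𝓔.et4 hδ hδ'
  have hX₃K := hΘ.le_add hcomp
  have hKDG := hΘ.le_add hK
  exact ⟨K, h', d, e, ⟨⟨_, hcomp⟩, by omega⟩, ⟨⟨_, hK⟩, by omega⟩⟩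

lemma exists_isStable_comp_deflation (hΘ : IsLengthFunction 𝓔 Θ) {X₁ X₂ X₃ D G : C}
    {f' : D ⟶ X₁} {f : X₁ ⟶ X₂} {g' : G ⟶ X₂} {g : X₂ ⟶ X₃} (hf : IsStable 𝓔 Θ f' f)
    (hg : IsStable 𝓔 Θ g' g) :
    ∃ (K : C) (h' : K ⟶ X₁) (d : D ⟶ K) (e : K ⟶ G),
      IsStable 𝓔 Θ h' (f ≫ g) ∧ IsStable 𝓔 Θ d e := by
  obtain ⟨⟨δ, hδ⟩, hX₁⟩ := hf
  obtain ⟨⟨δ', hδ'⟩, hX₂⟩ := hg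
  obtain ⟨K, h', d, e, δ'', hcomp, -, -, hK, -, -⟩ := 𝓔.et4_op hδ hδ'
  have hX₁K := hΘ.le_add hcomp
  have hKDG := hΘ.le_add hK
  exact ⟨K, h', d, e, ⟨⟨_, hcomp⟩, by omega⟩, ⟨⟨_, hK⟩, by omega⟩⟩

lemma isInflation_comp (hΘ : IsLengthFunction 𝓔 Θ) {X Y Z : C} {f : X ⟶ Y} {g : Y ⟶ Z}
    (hf : IsInflation 𝓔 Θ f) (hg : IsInflation 𝓔 Θ g) : IsInflation 𝓔 Θ (f ≫ g) := by
  obtain ⟨D, f', hf⟩ := hf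
  obtain ⟨G, g', hg⟩ := hg
  obtain ⟨K, h', -, -, h, -⟩ := hΘ.exists_isStable_comp_inflation hf hg
  exact ⟨K, h', h⟩

lemma isDeflation_comp (hΘ : IsLengthFunction 𝓔 Θ) {X Y Z : C} {f : X ⟶ Y} {g : Y ⟶ Z}
    (hf : IsDeflation 𝓔 Θ f) (hg : IsDeflation 𝓔 Θ g) : IsDeflation 𝓔 Θ (f ≫ g) := by
  obtain ⟨D, f', hf⟩ := hf
  obtain ⟨G, g', hg⟩ := hg
  obtain ⟨K, h', -, -, h, -⟩ := hΘ.exists_isStable_comp_deflation hf hg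
  exact ⟨K, h', h⟩

end IsLengthFunction

namespace IsLengthCategory

/- Split idempotents are not available a priori, so the idempotent `h.r ≫ h.i` is factored
through an object `Q` instead: either `X` is a retract of the shorter object `Q`, or the
idempotent is invertible. -/
lemma length_le_of_retract (hΘ : IsLengthCategory 𝓔 Θ) {X Y : C} (h : Retract X Y) :
    Θ X ≤ Θ Y := by
  induction hn : Θ Y using Nat.strong_induction_on generalizing Y with
  | h n ih =>
    subst hn
    obtain ⟨Q, i, j, hi, hj, hij⟩ := hΘ.isAdmissible (h.r ≫ h.i)
    by_cases hQ : Θ Q < Θ Y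
    · have hXQ : Retract X Q :=
        { i := h.i ≫ i
          r := j ≫ h.r
          retract := by simp [reassoc_of% hij] }
      exact (ih _ hQ hXQ rfl).trans hQ.le
    · have hYQ : Θ Y ≤ Θ Q := not_lt.1 hQ
      have := hΘ.isLengthFunction.isIso_of_isDeflation hi hYQ
      have hQY : Θ Y = Θ Q := hΘ.isLengthFunction.iso_invariant (asIso i)
      have := hΘ.isLengthFunction.isIso_of_isInflation hj hQY.le
      have : IsIso (h.r ≫ h.i) := hij ▸ inferInstance
      have : Mono h.r := mono_of_mono h.r h.i
      have : IsIso h.r := isIso_of_mono_of_isSplitEpi h.r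
      exact (hΘ.isLengthFunction.iso_invariant (asIso h.r)).ge

lemma isZero_of_isInflation_zero (hΘ : IsLengthCategory 𝓔 Θ) {X L : C}
    (h : IsInflation 𝓔 Θ (0 : X ⟶ L)) : IsZero X := by
  obtain ⟨M, y, h⟩ := h
  obtain ⟨r, hr⟩ := h.exists_desc (𝟙 L) zero_comp
  have hLM : Θ L ≤ Θ M := hΘ.length_le_of_retract ⟨y, r, hr⟩
  have hL : Θ L = Θ X + Θ M := h.2
  exact (hΘ.isLengthFunction.eq_zero_iff X).1 (by omega)

lemma isZero_of_isDeflation_zero (hΘ : IsLengthCategory 𝓔 Θ) {L M : C}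
    (h : IsDeflation 𝓔 Θ (0 : L ⟶ M)) : IsZero M := by
  obtain ⟨X, x, h⟩ := h
  obtain ⟨s, hs⟩ := h.exists_lift (𝟙 L) comp_zero
  have hLX : Θ L ≤ Θ X := hΘ.length_le_of_retract ⟨s, x, hs⟩
  have hL : Θ L = Θ X + Θ M := h.2
  exact (hΘ.isLengthFunction.eq_zero_iff M).1 (by omega)

end IsLengthCategory

section Closure

variable {S T : ObjectProperty C}

lemma fac_mono (h : S ≤ T) : fac 𝓔 Θ S ≤ fac 𝓔 Θ T :=
  fun _ ⟨X, y, hX, hy⟩ => ⟨X, y, h _ hX, hy⟩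

lemma sub_mono (h : S ≤ T) : sub 𝓔 Θ S ≤ sub 𝓔 Θ T :=
  fun _ ⟨X, x, hX, hx⟩ => ⟨X, x, h _ hX, hx⟩

lemma star_self_mono (h : S ≤ T) : star 𝓔 Θ S S ≤ star 𝓔 Θ T T :=
  fun _ ⟨X, Y, x, y, hX, hY, hxy⟩ => ⟨X, Y, x, y, h _ hX, h _ hY, hxy⟩

lemma filt_mono (h : S ≤ T) : filt 𝓔 Θ S ≤ filt 𝓔 Θ T := by
  intro M hM
  induction hM with
  | zero hM => exact .zero hM
  | step f g _ hfg hZ ih => exact .step f g ih hfg (h _ hZ)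

lemma filt_le (hzero : ∀ M, IsZero M → T M) (hstar : star 𝓔 Θ T T ≤ T) (h : S ≤ T) :
    filt 𝓔 Θ S ≤ T := by
  intro M hM
  induction hM with
  | zero hM => exact hzero _ hM
  | step f g _ hfg hZ ih => exact hstar _ ⟨_, _, f, g, ih, h _ hZ, hfg⟩

lemma le_filt (hΘ : IsLengthFunction 𝓔 Θ) : S ≤ filt 𝓔 Θ S :=
  fun M hM => .step _ _ (.zero (isZero_zero C))
    (hΘ.isStable_zero_iso (isZero_zero C) (Iso.refl M)) hM

lemma filt_of_iso (hΘ : IsLengthFunction 𝓔 Θ) {M N : C} (hM : filt 𝓔 Θ S M) (e : M ≅ N) :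
    filt 𝓔 Θ S N := by
  cases hM with
  | zero hM => exact .zero (hM.of_iso e.symm)
  | step f g hM hfg hZ => exact .step _ _ hM (hΘ.isStable_middle_iso hfg e) hZ

lemma filt_star_le (hΘ : IsLengthFunction 𝓔 Θ) :
    star 𝓔 Θ (filt 𝓔 Θ S) (filt 𝓔 Θ S) ≤ filt 𝓔 Θ S := by
  rintro M ⟨X, Y, x, y, hX, hY, h⟩
  induction hY generalizing M with
  | zero hY =>
    have := h.isIso_left hY
    exact filt_of_iso hΘ hX (asIso x)
  | step f g _ hfg hZ ih =>
    obtain ⟨K, h', d, e, hM, hK⟩ := hΘ.exists_isStable_comp_deflation h hfg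
    exact .step _ _ (ih K d e hK) hM hZ

lemma exists_finite_filt_biSup {ι : Type*} {L : Set ι} {P : ι → ObjectProperty C} {M : C}
    (hM : filt 𝓔 Θ (⨆ i ∈ L, P i) M) :
    ∃ S : Set ι, S ⊆ L ∧ S.Finite ∧ filt 𝓔 Θ (⨆ i ∈ S, P i) M := by
  induction hM with
  | zero hM => exact ⟨∅, Set.empty_subset _, Set.finite_empty, .zero hM⟩
  | step f g _ hfg hZ ih =>
    obtain ⟨S, hSL, hS, hM⟩ := ih
    simp only [ObjectProperty.prop_iSup_iff] at hZ
    obtain ⟨i, hi, hZ⟩ := hZ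
    exact ⟨insert i S, Set.insert_subset hi hSL, hS.insert i, .step f g
      (filt_mono (biSup_mono fun _ => Set.mem_insert_of_mem i) _ hM) hfg
      (le_biSup P (Set.mem_insert i S) _ hZ)⟩

end Closure

end Length

section Orthogonal

variable {C : Type u} [Category.{v} C]

section HasZeroMorphisms

variable [HasZeroMorphisms C]

lemma le_leftOrthogonal_iff {S T : ObjectProperty C} :
    S ≤ T.leftOrthogonal ↔ T ≤ S.rightOrthogonal :=
  ⟨fun h _ hY _ f hX => h _ hX f hY, fun h _ hX _ f hY => h _ hY f hX⟩

lemma rightOrthogonal_biSup {ι : Type*} (L : Set ι) (P : ι → ObjectProperty C) :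
    (⨆ i ∈ L, P i).rightOrthogonal = ⨅ i ∈ L, (P i).rightOrthogonal :=
  eq_of_forall_le_iff fun Q => by
    simp only [← le_leftOrthogonal_iff, iSup₂_le_iff, le_iInf₂_iff]

lemma leftOrthogonal_biSup {ι : Type*} (L : Set ι) (P : ι → ObjectProperty C) :
    (⨆ i ∈ L, P i).leftOrthogonal = ⨅ i ∈ L, (P i).leftOrthogonal :=
  eq_of_forall_le_iff fun Q => by
    simp only [le_leftOrthogonal_iff, iSup₂_le_iff, le_iInf₂_iff]

end HasZeroMorphisms

variable [Preadditive C] [HasZeroObject C] [HasBinaryBiproducts C]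
  {𝓔 : ExtriangulatedStructure.{w} C} {Θ : C → ℕ} {S : ObjectProperty C}

lemma rightOrthogonal_star_le :
    star 𝓔 Θ S.rightOrthogonal S.rightOrthogonal ≤ S.rightOrthogonal := by
  rintro M ⟨X, Y, x, y, hX, hY, h⟩ T f hT
  obtain ⟨g, rfl⟩ := h.exists_lift f (hY _ hT)
  rw [hX g hT, zero_comp]

lemma leftOrthogonal_star_le :
    star 𝓔 Θ S.leftOrthogonal S.leftOrthogonal ≤ S.leftOrthogonal := by
  rintro M ⟨X, Y, x, y, hX, hY, h⟩ T f hT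
  obtain ⟨g, rfl⟩ := h.exists_desc f (hX _ hT)
  rw [hY g hT, comp_zero]

lemma filt_le_leftOrthogonal_rightOrthogonal :
    filt 𝓔 Θ S ≤ S.rightOrthogonal.leftOrthogonal :=
  filt_le (fun _ hM _ _ _ => hM.eq_of_src _ _) leftOrthogonal_star_le
    (le_leftOrthogonal_iff.2 le_rfl)

lemma filt_le_rightOrthogonal_leftOrthogonal :
    filt 𝓔 Θ S ≤ S.leftOrthogonal.rightOrthogonal :=
  filt_le (fun _ hM _ _ _ => hM.eq_of_tgt _ _) rightOrthogonal_star_le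
    (le_leftOrthogonal_iff.1 le_rfl)

namespace IsLengthCategory

lemma exists_isInflation_of_not_rightOrthogonal (hΘ : IsLengthCategory 𝓔 Θ)
    (hS : fac 𝓔 Θ S ≤ S) {M : C} (hM : ¬ S.rightOrthogonal M) :
    ∃ (I : C) (j : I ⟶ M), S I ∧ ¬ IsZero I ∧ IsInflation 𝓔 Θ j := by
  rw [ObjectProperty.rightOrthogonal_iff] at hM
  push Not at hM
  obtain ⟨T, f, hT, hf⟩ := hM
  obtain ⟨I, i, j, hi, hj, rfl⟩ := hΘ.isAdmissible f
  exact ⟨I, j, hS _ ⟨T, i, hT, hi⟩, fun h => hf (by rw [h.eq_of_src j 0, comp_zero]), hj⟩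

lemma exists_isDeflation_of_not_leftOrthogonal (hΘ : IsLengthCategory 𝓔 Θ)
    (hS : sub 𝓔 Θ S ≤ S) {M : C} (hM : ¬ S.leftOrthogonal M) :
    ∃ (I : C) (i : M ⟶ I), S I ∧ ¬ IsZero I ∧ IsDeflation 𝓔 Θ i := by
  rw [ObjectProperty.leftOrthogonal_iff] at hM
  push Not at hM
  obtain ⟨T, f, hT, hf⟩ := hM
  obtain ⟨I, i, j, hi, hj, rfl⟩ := hΘ.isAdmissible f
  exact ⟨I, i, hS _ ⟨T, j, hT, hj⟩, fun h => hf (by rw [h.eq_of_src j 0, comp_zero]), hi⟩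

lemma sub_rightOrthogonal_le (hΘ : IsLengthCategory 𝓔 Θ) (hS : fac 𝓔 Θ S ≤ S) :
    sub 𝓔 Θ S.rightOrthogonal ≤ S.rightOrthogonal := by
  rintro M ⟨X, x, hX, hx⟩
  by_contra hM
  obtain ⟨I, j, hI, hI₀, hj⟩ := hΘ.exists_isInflation_of_not_rightOrthogonal hS hM
  have hjx : IsInflation 𝓔 Θ (j ≫ x) := hΘ.isLengthFunction.isInflation_comp hj hx
  rw [hX (j ≫ x) hI] at hjx
  exact hI₀ (hΘ.isZero_of_isInflation_zero hjx)

lemma fac_leftOrthogonal_le (hΘ : IsLengthCategory 𝓔 Θ) (hS : sub 𝓔 Θ S ≤ S) :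
    fac 𝓔 Θ S.leftOrthogonal ≤ S.leftOrthogonal := by
  rintro M ⟨X, y, hX, hy⟩
  by_contra hM
  obtain ⟨I, i, hI, hI₀, hi⟩ := hΘ.exists_isDeflation_of_not_leftOrthogonal hS hM
  have hyi : IsDeflation 𝓔 Θ (y ≫ i) := hΘ.isLengthFunction.isDeflation_comp hy hi
  rw [hX (y ≫ i) hI] at hyi
  exact hI₀ (hΘ.isZero_of_isDeflation_zero hyi)

/- Dévissage: a nonzero object of `Q` is not in `S^⊥`, so it has a nonzero `Θ`-subobject in `S`,
whose cone is a shorter object of `Q`. -/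
lemma fac_induction (hΘ : IsLengthCategory 𝓔 Θ) {P Q : ObjectProperty C}
    (hS : fac 𝓔 Θ S ≤ S) (hQ : fac 𝓔 Θ Q ≤ Q) (hQS : Q ≤ S.rightOrthogonal.leftOrthogonal)
    (zero : ∀ M, IsZero M → P M)
    (step : ∀ {I M N : C} (x : I ⟶ M) (y : M ⟶ N), IsStable 𝓔 Θ x y → S I → Q M → P N → P M) :
    Q ≤ P := by
  intro M hM
  induction hn : Θ M using Nat.strong_induction_on generalizing M with
  | h n ih =>
    subst hn
    by_cases hM₀ : IsZero M
    · exact zero M hM₀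
    have hMS : ¬ S.rightOrthogonal M :=
      fun h => hM₀ ((IsZero.iff_id_eq_zero M).2 (hQS _ hM (𝟙 M) h))
    obtain ⟨I, x, hI, hI₀, N, y, hxy⟩ := hΘ.exists_isInflation_of_not_rightOrthogonal hS hMS
    have hNM : Θ N < Θ M := by
      have := hΘ.isLengthFunction.length_pos hI₀
      have := hxy.2
      omega
    exact step x y hxy hI hM (ih _ hNM N (hQ _ ⟨M, y, hM, I, x, hxy⟩) rfl)

lemma sub_induction (hΘ : IsLengthCategory 𝓔 Θ) {P Q : ObjectProperty C}
    (hS : sub 𝓔 Θ S ≤ S) (hQ : sub 𝓔 Θ Q ≤ Q) (hQS : Q ≤ S.leftOrthogonal.rightOrthogonal)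
    (zero : ∀ M, IsZero M → P M)
    (step : ∀ {N M I : C} (x : N ⟶ M) (y : M ⟶ I), IsStable 𝓔 Θ x y → S I → Q M → P N → P M) :
    Q ≤ P := by
  intro M hM
  induction hn : Θ M using Nat.strong_induction_on generalizing M with
  | h n ih =>
    subst hn
    by_cases hM₀ : IsZero M
    · exact zero M hM₀
    have hMS : ¬ S.leftOrthogonal M :=
      fun h => hM₀ ((IsZero.iff_id_eq_zero M).2 (hQS _ hM (𝟙 M) h))
    obtain ⟨I, y, hI, hI₀, N, x, hxy⟩ := hΘ.exists_isDeflation_of_not_leftOrthogonal hS hMS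
    have hNM : Θ N < Θ M := by
      have := hΘ.isLengthFunction.length_pos hI₀
      have := hxy.2
      omega
    exact step x y hxy hI hM (ih _ hNM N (hQ _ ⟨M, x, hM, I, y, hxy⟩) rfl)

lemma filt_eq_leftOrthogonal_rightOrthogonal (hΘ : IsLengthCategory 𝓔 Θ)
    (hS : fac 𝓔 Θ S ≤ S) : filt 𝓔 Θ S = S.rightOrthogonal.leftOrthogonal :=
  filt_le_leftOrthogonal_rightOrthogonal.antisymm <|
    hΘ.fac_induction hS (hΘ.fac_leftOrthogonal_le (hΘ.sub_rightOrthogonal_le hS)) le_rfl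
      (fun _ => .zero) fun x y hxy hI _ hN =>
        filt_star_le hΘ.isLengthFunction _
          ⟨_, _, x, y, le_filt hΘ.isLengthFunction _ hI, hN, hxy⟩

lemma filt_eq_rightOrthogonal_leftOrthogonal (hΘ : IsLengthCategory 𝓔 Θ)
    (hS : sub 𝓔 Θ S ≤ S) : filt 𝓔 Θ S = S.leftOrthogonal.rightOrthogonal :=
  filt_le_rightOrthogonal_leftOrthogonal.antisymm <|
    hΘ.sub_induction hS (hΘ.sub_rightOrthogonal_le (hΘ.fac_leftOrthogonal_le hS)) le_rfl
      (fun _ => .zero) fun x y hxy hI _ hN => .step x y hN hxy hI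

end IsLengthCategory

end Orthogonal

section Classes

variable {C : Type u} [Category.{v} C] [Preadditive C] [HasZeroObject C] [HasBinaryBiproducts C]
  {𝓔 : ExtriangulatedStructure.{w} C} {Θ : C → ℕ}

/- The order and lattice instances are scoped: globally they would compete with the lattice
structures that `theorem4` quantifies over. -/
scoped instance TorsionClass.instPartialOrder : PartialOrder (TorsionClass 𝓔 Θ) :=
  PartialOrder.lift TorsionClass.obj fun ⟨_, _, _, _, _⟩ ⟨_, _, _, _, _⟩ h => by congr

scoped instance TorsionFreeClass.instPartialOrder : PartialOrder (TorsionFreeClass 𝓔 Θ) :=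
  PartialOrder.lift TorsionFreeClass.obj fun ⟨_, _, _, _, _⟩ ⟨_, _, _, _, _⟩ h => by congr

lemma fac_biSup_obj_le (L : Set (TorsionClass 𝓔 Θ)) :
    fac 𝓔 Θ (⨆ T ∈ L, T.obj) ≤ ⨆ T ∈ L, T.obj := by
  rintro M ⟨X, y, hX, hy⟩
  simp only [ObjectProperty.prop_iSup_iff] at hX ⊢
  obtain ⟨T, hT, hX⟩ := hX
  exact ⟨T, hT, T.fac_le _ ⟨X, y, hX, hy⟩⟩

lemma sub_biSup_obj_le (L : Set (TorsionFreeClass 𝓔 Θ)) :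
    sub 𝓔 Θ (⨆ F ∈ L, F.obj) ≤ ⨆ F ∈ L, F.obj := by
  rintro M ⟨X, x, hX, hx⟩
  simp only [ObjectProperty.prop_iSup_iff] at hX ⊢
  obtain ⟨F, hF, hX⟩ := hX
  exact ⟨F, hF, F.sub_le _ ⟨X, x, hX, hx⟩⟩

section LengthFunction

/- The lattice instances depend on the length function axioms, which are not a class; hence the
`Fact`. -/
variable [hΘ : Fact (IsLengthFunction 𝓔 Θ)]

namespace TorsionClass

lemma obj_of_isZero (T : TorsionClass 𝓔 Θ) {M : C} (hM : IsZero M) : T.obj M := by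
  obtain ⟨X, hX⟩ := T.nonempty
  exact T.fac_le _ ⟨X, 0, hX, X, 𝟙 X, hΘ.out.isStable_iso_zero (Iso.refl X) hM⟩

/-- The intersection of a set of torsion classes, which is their meet. -/
def inter (L : Set (TorsionClass 𝓔 Θ)) : TorsionClass 𝓔 Θ where
  obj := ⨅ T ∈ L, T.obj
  nonempty := ⟨0, by
    simp only [iInf_apply, iInf_Prop_eq]
    exact fun T _ => T.obj_of_isZero (isZero_zero C)⟩
  isClosedUnderIso := ⟨fun e h => by
    simp only [iInf_apply, iInf_Prop_eq] at h ⊢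
    exact fun T hT => T.isClosedUnderIso.of_iso e (h T hT)⟩
  fac_le := le_iInf₂ fun T hT => (fac_mono (biInf_le _ hT)).trans T.fac_le
  star_le := le_iInf₂ fun T hT => (star_self_mono (biInf_le _ hT)).trans T.star_le

scoped instance instCompleteLattice : CompleteLattice (TorsionClass 𝓔 Θ) :=
  letI : InfSet (TorsionClass 𝓔 Θ) := ⟨inter⟩
  completeLatticeOfInf _ fun L => ⟨fun _ hT => biInf_le obj hT, fun _ hT =>
    le_iInf₂ (f := fun U (_ : U ∈ L) => U.obj) fun _ hU => hT hU⟩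

lemma sInf_obj (L : Set (TorsionClass 𝓔 Θ)) : (sInf L).obj = ⨅ T ∈ L, T.obj :=
  rfl

lemma inf_obj (T U : TorsionClass 𝓔 Θ) : (T ⊓ U).obj = T.obj ⊓ U.obj := by
  rw [← sInf_pair, sInf_obj, iInf_pair]

end TorsionClass

namespace TorsionFreeClass

lemma obj_of_isZero (F : TorsionFreeClass 𝓔 Θ) {M : C} (hM : IsZero M) : F.obj M := by
  obtain ⟨X, hX⟩ := F.nonempty
  exact F.sub_le _ ⟨X, 0, hX, X, 𝟙 X, hΘ.out.isStable_zero_iso hM (Iso.refl X)⟩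

/-- The intersection of a set of torsion-free classes, which is their meet. -/
def inter (L : Set (TorsionFreeClass 𝓔 Θ)) : TorsionFreeClass 𝓔 Θ where
  obj := ⨅ F ∈ L, F.obj
  nonempty := ⟨0, by
    simp only [iInf_apply, iInf_Prop_eq]
    exact fun F _ => F.obj_of_isZero (isZero_zero C)⟩
  isClosedUnderIso := ⟨fun e h => by
    simp only [iInf_apply, iInf_Prop_eq] at h ⊢
    exact fun F hF => F.isClosedUnderIso.of_iso e (h F hF)⟩
  sub_le := le_iInf₂ fun F hF => (sub_mono (biInf_le _ hF)).trans F.sub_le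
  star_le := le_iInf₂ fun F hF => (star_self_mono (biInf_le _ hF)).trans F.star_le

scoped instance instCompleteLattice : CompleteLattice (TorsionFreeClass 𝓔 Θ) :=
  letI : InfSet (TorsionFreeClass 𝓔 Θ) := ⟨inter⟩
  completeLatticeOfInf _ fun L => ⟨fun _ hF => biInf_le obj hF, fun _ hF =>
    le_iInf₂ (f := fun G (_ : G ∈ L) => G.obj) fun _ hG => hF hG⟩

lemma sInf_obj (L : Set (TorsionFreeClass 𝓔 Θ)) : (sInf L).obj = ⨅ F ∈ L, F.obj :=
  rfl

lemma inf_obj (F G : TorsionFreeClass 𝓔 Θ) : (F ⊓ G).obj = F.obj ⊓ G.obj := by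
  rw [← sInf_pair, sInf_obj, iInf_pair]

end TorsionFreeClass

end LengthFunction

open scoped TorsionClass TorsionFreeClass

section LengthCategory

variable [hΘ : Fact (IsLengthCategory 𝓔 Θ)]

instance instFactIsLengthFunction : Fact (IsLengthFunction 𝓔 Θ) :=
  ⟨hΘ.out.isLengthFunction⟩

lemma TorsionClass.leftOrthogonal_rightOrthogonal (T : TorsionClass 𝓔 Θ) :
    T.obj.rightOrthogonal.leftOrthogonal = T.obj := by
  rw [← hΘ.out.filt_eq_leftOrthogonal_rightOrthogonal T.fac_le]
  exact (filt_le (fun _ => T.obj_of_isZero) T.star_le le_rfl).antisymm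
    (le_filt hΘ.out.isLengthFunction)

lemma TorsionFreeClass.rightOrthogonal_leftOrthogonal (F : TorsionFreeClass 𝓔 Θ) :
    F.obj.leftOrthogonal.rightOrthogonal = F.obj := by
  rw [← hΘ.out.filt_eq_rightOrthogonal_leftOrthogonal F.sub_le]
  exact (filt_le (fun _ => F.obj_of_isZero) F.star_le le_rfl).antisymm
    (le_filt hΘ.out.isLengthFunction)

/-- The torsion class `^⊥F` of a torsion-free class `F`. -/
def TorsionFreeClass.leftOrthogonal (F : TorsionFreeClass 𝓔 Θ) : TorsionClass 𝓔 Θ where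
  obj := F.obj.leftOrthogonal
  nonempty := ⟨0, fun _ _ _ => (isZero_zero C).eq_of_src _ _⟩
  isClosedUnderIso := inferInstance
  fac_le := hΘ.out.fac_leftOrthogonal_le F.sub_le
  star_le := leftOrthogonal_star_le

/-- The torsion-free class `T^⊥` of a torsion class `T`. -/
def TorsionClass.rightOrthogonal (T : TorsionClass 𝓔 Θ) : TorsionFreeClass 𝓔 Θ where
  obj := T.obj.rightOrthogonal
  nonempty := ⟨0, fun _ _ _ => (isZero_zero C).eq_of_tgt _ _⟩
  isClosedUnderIso := inferInstance
  sub_le := hΘ.out.sub_rightOrthogonal_le T.fac_le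
  star_le := rightOrthogonal_star_le

variable (𝓔 Θ) in
/-- The anti-isomorphism `T ↦ T^⊥` between torsion classes and torsion-free classes, with inverse
`F ↦ ^⊥F`. -/
def orthogonalOrderIso : TorsionClass 𝓔 Θ ≃o (TorsionFreeClass 𝓔 Θ)ᵒᵈ where
  toFun T := OrderDual.toDual T.rightOrthogonal
  invFun F := (OrderDual.ofDual F).leftOrthogonal
  left_inv T := le_antisymm T.leftOrthogonal_rightOrthogonal.le T.leftOrthogonal_rightOrthogonal.ge
  right_inv F := le_antisymm (α := TorsionFreeClass 𝓔 Θ)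
    (OrderDual.ofDual F).rightOrthogonal_leftOrthogonal.le
    (OrderDual.ofDual F).rightOrthogonal_leftOrthogonal.ge
  map_rel_iff' {T U} := by
    change U.obj.rightOrthogonal ≤ T.obj.rightOrthogonal ↔ T.obj ≤ U.obj
    rw [← le_leftOrthogonal_iff, U.leftOrthogonal_rightOrthogonal]

namespace TorsionClass

lemma rightOrthogonal_sSup_obj (L : Set (TorsionClass 𝓔 Θ)) :
    (sSup L).obj.rightOrthogonal = ⨅ T ∈ L, T.obj.rightOrthogonal :=
  (congrArg (fun F : (TorsionFreeClass 𝓔 Θ)ᵒᵈ => (OrderDual.ofDual F).obj)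
    (map_sSup (orthogonalOrderIso 𝓔 Θ) L)).trans iInf_image

lemma sSup_obj_eq_leftOrthogonal (L : Set (TorsionClass 𝓔 Θ)) :
    (sSup L).obj = (⨅ T ∈ L, T.obj.rightOrthogonal).leftOrthogonal := by
  rw [← rightOrthogonal_sSup_obj, leftOrthogonal_rightOrthogonal]

lemma sSup_obj_eq_filt (L : Set (TorsionClass 𝓔 Θ)) :
    (sSup L).obj = filt 𝓔 Θ (⨆ T ∈ L, T.obj) := by
  rw [sSup_obj_eq_leftOrthogonal, ← rightOrthogonal_biSup,
    hΘ.out.filt_eq_leftOrthogonal_rightOrthogonal (fac_biSup_obj_le L)]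

end TorsionClass

namespace TorsionFreeClass

lemma leftOrthogonal_sSup_obj (L : Set (TorsionFreeClass 𝓔 Θ)) :
    (sSup L).obj.leftOrthogonal = ⨅ F ∈ L, F.obj.leftOrthogonal :=
  (congrArg TorsionClass.obj
    (map_sInf (orthogonalOrderIso 𝓔 Θ).symm (OrderDual.ofDual ⁻¹' L))).trans iInf_image

lemma sSup_obj_eq_rightOrthogonal (L : Set (TorsionFreeClass 𝓔 Θ)) :
    (sSup L).obj = (⨅ F ∈ L, F.obj.leftOrthogonal).rightOrthogonal := by
  rw [← leftOrthogonal_sSup_obj, rightOrthogonal_leftOrthogonal]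

lemma sSup_obj_eq_filt (L : Set (TorsionFreeClass 𝓔 Θ)) :
    (sSup L).obj = filt 𝓔 Θ (⨆ F ∈ L, F.obj) := by
  rw [sSup_obj_eq_rightOrthogonal, ← leftOrthogonal_biSup,
    hΘ.out.filt_eq_rightOrthogonal_leftOrthogonal (sub_biSup_obj_le L)]

end TorsionFreeClass

end LengthCategory

end Classes

open scoped TorsionClass TorsionFreeClass

section Semidistributive

/-- The half of complete semidistributivity that concerns meets with a join; the other half is this
property for the order dual. -/
def IsCompletelyMeetSemidistributive (P : Type*) [CompleteLattice P] : Prop :=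
  ∀ (x : P) (L : Set P), (∀ y ∈ L, ∀ z ∈ L, x ⊓ y = x ⊓ z) → ∀ y ∈ L, x ⊓ sSup L = x ⊓ y

lemma IsCompletelyMeetSemidistributive.of_orderIso {P Q : Type*} [CompleteLattice P]
    [CompleteLattice Q] (h : IsCompletelyMeetSemidistributive P) (e : P ≃o Q) :
    IsCompletelyMeetSemidistributive Q := by
  intro x L hL y hy
  have := h (e.symm x) (e.symm '' L)
    (by
      rintro _ ⟨y, hy, rfl⟩ _ ⟨z, hz, rfl⟩
      rw [← map_inf, ← map_inf, hL y hy z hz])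
    (e.symm y) ⟨y, hy, rfl⟩
  rwa [← map_sSup, ← map_inf, ← map_inf, e.symm.injective.eq_iff] at this

lemma IsCompletelyMeetSemidistributive.isCompletelySemidistributive {P : Type*}
    [CompleteLattice P] (h : IsCompletelyMeetSemidistributive P)
    (hd : IsCompletelyMeetSemidistributive Pᵒᵈ) : IsCompletelySemidistributive P :=
  fun x L => ⟨h x L, hd (OrderDual.toDual x) (OrderDual.ofDual ⁻¹' L)⟩

variable {C : Type u} [Category.{v} C] [Preadditive C] [HasZeroObject C] [HasBinaryBiproducts C]
  {𝓔 : ExtriangulatedStructure.{w} C} {Θ : C → ℕ} [hΘ : Fact (IsLengthCategory 𝓔 Θ)]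

lemma TorsionClass.isCompletelyMeetSemidistributive :
    IsCompletelyMeetSemidistributive (TorsionClass 𝓔 Θ) := by
  refine fun T L hL U hU => le_antisymm ?_ (inf_le_inf_left T (le_sSup hU))
  refine hΘ.out.fac_induction (fac_biSup_obj_le L) (T ⊓ sSup L).fac_le ?_
    (fun _ => (T ⊓ U).obj_of_isZero) ?_
  · rw [rightOrthogonal_biSup, ← sSup_obj_eq_leftOrthogonal]
    exact (inf_le_right : T ⊓ sSup L ≤ sSup L)
  · intro I M N x y hxy hI hM hN
    simp only [ObjectProperty.prop_iSup_iff] at hI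
    obtain ⟨V, hV, hI⟩ := hI
    rw [hL U hU V hV, inf_obj] at hN ⊢
    exact ⟨(inf_le_left : T ⊓ sSup L ≤ T) _ hM, V.star_le _ ⟨I, N, x, y, hI, hN.2, hxy⟩⟩

lemma TorsionFreeClass.isCompletelyMeetSemidistributive :
    IsCompletelyMeetSemidistributive (TorsionFreeClass 𝓔 Θ) := by
  refine fun F L hL G hG => le_antisymm ?_ (inf_le_inf_left F (le_sSup hG))
  refine hΘ.out.sub_induction (sub_biSup_obj_le L) (F ⊓ sSup L).sub_le ?_
    (fun _ => (F ⊓ G).obj_of_isZero) ?_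
  · rw [leftOrthogonal_biSup, ← sSup_obj_eq_rightOrthogonal]
    exact (inf_le_right : F ⊓ sSup L ≤ sSup L)
  · intro N M I x y hxy hI hM hN
    simp only [ObjectProperty.prop_iSup_iff] at hI
    obtain ⟨H, hH, hI⟩ := hI
    rw [hL G hG H hH, inf_obj] at hN ⊢
    exact ⟨(inf_le_left : F ⊓ sSup L ≤ F) _ hM, H.star_le _ ⟨N, I, x, y, hN.2, hI, hxy⟩⟩

lemma TorsionClass.isCompletelySemidistributive :
    IsCompletelySemidistributive (TorsionClass 𝓔 Θ) :=
  isCompletelyMeetSemidistributive.isCompletelySemidistributive <|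
    TorsionFreeClass.isCompletelyMeetSemidistributive.of_orderIso <|
      (OrderIso.dualDual _).trans (orthogonalOrderIso 𝓔 Θ).symm.dual

end Semidistributive

namespace TorsionClass

variable {C : Type u} [Category.{v} C] [Preadditive C] [HasZeroObject C] [HasBinaryBiproducts C]
  {𝓔 : ExtriangulatedStructure.{w} C} {Θ : C → ℕ}

variable (𝓔 Θ) in
/-- The torsion class generated by an object, that is, the smallest one containing it. -/
def generate [Fact (IsLengthFunction 𝓔 Θ)] (M : C) : TorsionClass 𝓔 Θ :=
  sInf {T | T.obj M}

lemma generate_le_iff [Fact (IsLengthFunction 𝓔 Θ)] {M : C} {T : TorsionClass 𝓔 Θ} :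
    generate 𝓔 Θ M ≤ T ↔ T.obj M := by
  refine ⟨fun h => h M ?_, fun h => sInf_le h⟩
  simp only [generate, sInf_obj, iInf_apply, iInf_Prop_eq]
  exact fun _ hU => hU

variable [Fact (IsLengthCategory 𝓔 Θ)]

lemma exists_finite_generate_le_sSup {M : C} {L : Set (TorsionClass 𝓔 Θ)}
    (h : generate 𝓔 Θ M ≤ sSup L) :
    ∃ S : Set (TorsionClass 𝓔 Θ), S ⊆ L ∧ S.Finite ∧ generate 𝓔 Θ M ≤ sSup S := by
  simp only [generate_le_iff, sSup_obj_eq_filt] at h ⊢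
  exact exists_finite_filt_biSup h

lemma isAlgebraicLattice : IsAlgebraicLattice (TorsionClass 𝓔 Θ) := by
  refine fun T => ⟨generate 𝓔 Θ '' {M | T.obj M}, le_antisymm (fun M hM => ?_) (sSup_le ?_), ?_⟩
  · exact generate_le_iff.1 (le_sSup ⟨M, hM, rfl⟩)
  · rintro _ ⟨M, hM, rfl⟩
    exact generate_le_iff.2 hM
  · rintro _ ⟨M, -, rfl⟩ L
    exact exists_finite_generate_le_sSup

end TorsionClass

end Extri

theorem theorem4 {C : Type u} [Category.{v} C] [Preadditive C] [HasZeroObject C]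
    [HasBinaryBiproducts C]
    (𝓔 : Extri.ExtriangulatedStructure.{w} C) (Θ : C → ℕ)
    (hΘ : Extri.IsLengthCategory 𝓔 Θ) :
    ∃ (_ : CompleteLattice (Extri.TorsionClass 𝓔 Θ))
      (_ : CompleteLattice (Extri.TorsionFreeClass 𝓔 Θ)),
      -- the orders are the inclusions
      (∀ T U : Extri.TorsionClass 𝓔 Θ, T ≤ U ↔ T.obj ≤ U.obj) ∧
      (∀ F G : Extri.TorsionFreeClass 𝓔 Θ, F ≤ G ↔ F.obj ≤ G.obj) ∧
      -- joins and meets of torsion classes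
      (∀ L : Set (Extri.TorsionClass 𝓔 Θ),
        (sSup L).obj = (⨅ T ∈ L, T.obj.rightOrthogonal).leftOrthogonal ∧
        (sSup L).obj = Extri.filt 𝓔 Θ (⨆ T ∈ L, T.obj) ∧
        (sInf L).obj = ⨅ T ∈ L, T.obj) ∧
      -- joins and meets of torsion-free classes
      (∀ L : Set (Extri.TorsionFreeClass 𝓔 Θ),
        (sSup L).obj = (⨅ F ∈ L, F.obj.leftOrthogonal).rightOrthogonal ∧
        (sSup L).obj = Extri.filt 𝓔 Θ (⨆ F ∈ L, F.obj) ∧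
        (sInf L).obj = ⨅ F ∈ L, F.obj) ∧
      -- the isomorphism of complete lattices `T ↦ T^⊥`
      (∃ e : Extri.TorsionClass 𝓔 Θ ≃o (Extri.TorsionFreeClass 𝓔 Θ)ᵒᵈ,
        (∀ T, (OrderDual.ofDual (e T)).obj = T.obj.rightOrthogonal) ∧
        (∀ L, e (sSup L) = sSup (e '' L)) ∧ (∀ L, e (sInf L) = sInf (e '' L))) ∧
      Extri.IsCompletelySemidistributive (Extri.TorsionClass 𝓔 Θ) ∧
      Extri.IsAlgebraicLattice (Extri.TorsionClass 𝓔 Θ) := by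
  have := Fact.mk hΘ
  open scoped Extri.TorsionClass Extri.TorsionFreeClass in
  exact ⟨inferInstance, inferInstance, fun _ _ => Iff.rfl, fun _ _ => Iff.rfl,
    fun L => ⟨Extri.TorsionClass.sSup_obj_eq_leftOrthogonal L,
      Extri.TorsionClass.sSup_obj_eq_filt L, Extri.TorsionClass.sInf_obj L⟩,
    fun L => ⟨Extri.TorsionFreeClass.sSup_obj_eq_rightOrthogonal L,
      Extri.TorsionFreeClass.sSup_obj_eq_filt L, Extri.TorsionFreeClass.sInf_obj L⟩,
    ⟨Extri.orthogonalOrderIso 𝓔 Θ, fun _ => rfl,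
      fun L => by rw [OrderIso.map_sSup, sSup_image],
      fun L => by rw [OrderIso.map_sInf, sInf_image]⟩,
    Extri.TorsionClass.isCompletelySemidistributive,
    Extri.TorsionClass.isAlgebraicLattice⟩
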